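/- Let $(X,\|\cdot\|)$ be a reflexive real Banach space with dual $(X^*,\|\cdot\|_*)$, and let $f\colon X\to\mathbb{R}$ and $\psi\colon X\to\mathbb{R}$ be convex and closed (i.e. with closed epigraph). Let $L,\sigma>0$. Assume that $f$ is $L$-smooth, i.e. differentiable with $\|\nabla f(x)-\nabla f(y)\|_*\le L\|x-y\|$ for all $x,y\in X$, and that $\psi$ is $\sigma$-strongly convex, i.e. $\psi(y)\ge\psi(x)+\langle g,y-x\rangle+\frac{\sigma}{2}\|y-x\|^2$ for all $x,y\in X$ and every subgradient $g\in\partial\psi(x)$. Let $\psi^*(u)=\sup_{x\in X}\{\langle u,x\rangle-\psi(x)\}\in[-\infty,\infty]$, $u\in X^*$, be the convex conjugate of $\psi$. Let $N\ge 1$, and let $\theta_{-2}=\theta_{-1}=0<\theta_0\le\theta_1\le\dots\le\theta_N$ satisfy $\theta_i^2-\theta_i\le\theta_{i-1}^2$ for $0\le i\le N-1$ and $\theta_N=\theta_{N-1}$. Given $q_0\in X$, the dual accelerated mirror descent method (dual-AMD) sets $$g_0=\frac{1}{\theta_N^2}\nabla f(q_0),\qquad r_0=\frac{\theta_N^2-\theta_{N-2}^2}{\theta_N^2}\nabla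 f(q_0),$$ and, for $k=0,1,\dots,N-1$, $$q_{k+1}=q_k-\frac{\sigma}{L}\left(\theta_{N-k-1}^2-\theta_{N-k-2}^2\right)\nabla\psi^*(r_k),$$ $$g_{k+1}=g_k+\frac{1}{\theta_{N-k-1}^2}\left(\nabla f(q_{k+1})-\nabla f(q_k)\right),$$ $$r_{k+1}=r_k+\left(\theta_{N-k-1}^2-\theta_{N-k-2}^2\right)(g_{k+1}-g_k)+\left(\theta_{N-k-2}^2-\theta_{N-k-3}^2\right)g_{k+1}.$$ Then the iterates are well defined: at every $u\in X^*$ the function $\psi^*$ is finite near $u$ and Fréchet differentiable at $u$, with a gradient $\nabla\psi^*(u)$ that belongs to $X$ (as a subspace of $X^{**}$), so that there is exactly one sequence $(q_k,g_k,r_k)_{k=0}^N$ as above. Moreover $r_N=\nabla f(q_N)$. If, in addition, $\psi^*(0)=0$ and $0\in X^*$ is the unique minimizer of $\psi^*$, then $$\psi^*(\nabla f(q_N))=\psi^*(r_N)\le\frac{L}{\sigma\theta_N^2}\Big(f(q_0)-\inf_{x\in X}f(x)\Big),$$ where the right-hand side is $+\infty$ if $\inf_{x\in X} f(x)=-\infty$.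 If moreover $\theta_i^2-\theta_i=\theta_{i-1}^2$ for $0\le i\le N-1$, then this right-hand side is $\mathcal{O}\big(L(f(q_0)-\inf_{x\in X} f(x))/(\sigma N^2)\big)$; specifically, it is at most $\frac{4L}{\sigma N^2}\big(f(q_0)-\inf_{x\in X} f(x)\big)$. -/

import Mathlib

open Filter Topology

namespace DualAMD

noncomputable section

/-- `X` is reflexive: the canonical isometric embedding `X → X**` is onto. -/
def IsReflexive (X : Type*) [NormedAddCommGroup X] [NormedSpace ℝ X] : Prop :=
  Function.Surjective (NormedSpace.inclusionInDoubleDual ℝ X)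

/-- A real-valued function is convex, closed (its epigraph is closed) and proper. Properness is
automatic for real-valued functions. -/
structure IsCCP {X : Type*} [NormedAddCommGroup X] [NormedSpace ℝ X] (h : X → ℝ) : Prop where
  convex : ConvexOn ℝ Set.univ h
  closed : IsClosed {p : X × ℝ | h p.1 ≤ p.2}

/-- `f` is `L`-smooth: it is differentiable and its gradient, an element of the dual space, is
`L`-Lipschitz from the norm of `X` to the dual norm. -/
structure IsLSmooth {X : Type*} [NormedAddCommGroup X] [NormedSpace ℝ X]
    (L : ℝ) (f : X → ℝ) : Prop where
  differentiable : Differentiable ℝ f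
  lipschitz : ∀ x y : X, ‖fderiv ℝ f x - fderiv ℝ f y‖ ≤ L * ‖x - y‖

/-- The set of subgradients of `h` at `x`. -/
def subdifferential {X : Type*} [NormedAddCommGroup X] [NormedSpace ℝ X]
    (h : X → ℝ) (x : X) : Set (StrongDual ℝ X) :=
  {g | ∀ y : X, h x + g (y - x) ≤ h y}

/-- `h` is `σ`-strongly convex: the strong convexity inequality holds for every subgradient. -/
def IsStronglyConvex {X : Type*} [NormedAddCommGroup X] [NormedSpace ℝ X]
    (σ : ℝ) (h : X → ℝ) : Prop :=
  ∀ x y : X, ∀ g ∈ subdifferential h x, h x + g (y - x) + σ / 2 * ‖y - x‖ ^ 2 ≤ h y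

/-- The convex conjugate `h*(u) = sup_x (⟨u, x⟩ - h x)`, with values in the extended reals. -/
def conj {X : Type*} [NormedAddCommGroup X] [NormedSpace ℝ X]
    (h : X → ℝ) (u : StrongDual ℝ X) : EReal :=
  ⨆ x : X, ((u x - h x : ℝ) : EReal)

/-- `F : X* → [-∞, ∞]` is finite near `u`, Fréchet differentiable at `u`, and its gradient there,
an element of `X**`, is (the image of) `x : X`. -/
structure HasGradient {X : Type*} [NormedAddCommGroup X] [NormedSpace ℝ X]
    (F : StrongDual ℝ X → EReal) (u : StrongDual ℝ X) (x : X) : Prop where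
  finite : ∀ᶠ v in 𝓝 u, F v ≠ ⊥ ∧ F v ≠ ⊤
  hasFDerivAt :
    HasFDerivAt (fun v => (F v).toReal) (NormedSpace.inclusionInDoubleDual ℝ X x) u

/-- Admissible parameters `θ_{-2}, θ_{-1}, θ_0, …, θ_N` of the method (the values of `θ` at other
indices play no role). -/
structure IsParamSeq (N : ℕ) (θ : ℤ → ℝ) : Prop where
  neg_two : θ (-2) = 0
  neg_one : θ (-1) = 0
  pos : ∀ i : ℤ, 0 ≤ i → i ≤ N → 0 < θ i
  mono : ∀ i : ℤ, 0 ≤ i → i < N → θ i ≤ θ (i + 1)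
  step : ∀ i : ℤ, 0 ≤ i → i < N → θ i ^ 2 - θ i ≤ θ (i - 1) ^ 2
  last : θ N = θ (N - 1)

/-- The sequences `q_0, …, q_N` in `X` and `g_0, …, g_N`, `r_0, …, r_N` in `X*`. -/
structure Trajectory (X : Type*) [NormedAddCommGroup X] [NormedSpace ℝ X] (N : ℕ) where
  q : Fin (N + 1) → X
  g : Fin (N + 1) → StrongDual ℝ X
  r : Fin (N + 1) → StrongDual ℝ X

/-- `z` is produced by `N` steps of dual accelerated mirror descent started at `q0`. -/
structure IsDualAMD {X : Type*} [NormedAddCommGroup X] [NormedSpace ℝ X]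
    (f ψ : X → ℝ) (L σ : ℝ) (N : ℕ) (θ : ℤ → ℝ) (q0 : X) (z : Trajectory X N) : Prop where
  q_zero : z.q 0 = q0
  g_zero : z.g 0 = (1 / θ N ^ 2) • fderiv ℝ f (z.q 0)
  r_zero : z.r 0 = ((θ N ^ 2 - θ (N - 2) ^ 2) / θ N ^ 2) • fderiv ℝ f (z.q 0)
  q_succ : ∀ k : Fin N, ∃ x : X, HasGradient (conj ψ) (z.r k.castSucc) x ∧
    z.q k.succ = z.q k.castSucc -
      (σ / L * (θ ((N : ℤ) - (k : ℕ) - 1) ^ 2 - θ ((N : ℤ) - (k : ℕ) - 2) ^ 2)) • x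
  g_succ : ∀ k : Fin N, z.g k.succ = z.g k.castSucc +
    (1 / θ ((N : ℤ) - (k : ℕ) - 1) ^ 2) •
      (fderiv ℝ f (z.q k.succ) - fderiv ℝ f (z.q k.castSucc))
  r_succ : ∀ k : Fin N, z.r k.succ = z.r k.castSucc +
    (θ ((N : ℤ) - (k : ℕ) - 1) ^ 2 - θ ((N : ℤ) - (k : ℕ) - 2) ^ 2) •
      (z.g k.succ - z.g k.castSucc) +
    (θ ((N : ℤ) - (k : ℕ) - 2) ^ 2 - θ ((N : ℤ) - (k : ℕ) - 3) ^ 2) • z.g k.succ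

end

end DualAMD

namespace DualAMD

section Subgradients

variable {X : Type*} [NormedAddCommGroup X] [NormedSpace ℝ X]

/-- A real-valued closed convex function on a Banach space is continuous, by the Baire category
theorem. -/
theorem IsCCP.continuous [CompleteSpace X] {h : X → ℝ} (hh : IsCCP h) : Continuous h := by
  have hclosed : ∀ n : ℕ, IsClosed {x : X | h x ≤ n} := fun n =>
    hh.closed.preimage (f := fun x : X => (x, (n : ℝ))) (by fun_prop)
  have hunion : ⋃ n : ℕ, {x : X | h x ≤ n} = Set.univ :=
    Set.eq_univ_of_forall fun x => Set.mem_iUnion.2 (exists_nat_ge (h x))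
  obtain ⟨n, x₀, hx₀⟩ := nonempty_interior_of_iUnion_of_closed hclosed hunion
  have hbdd : (𝓝 x₀).IsBoundedUnder (· ≤ ·) h :=
    ⟨n, eventually_map.2 (mem_interior_iff_mem_nhds.1 hx₀)⟩
  have htfae : (∃ x₀ ∈ Set.univ, (𝓝 x₀).IsBoundedUnder (· ≤ ·) h) ↔ ContinuousOn h Set.univ :=
    (hh.convex.continuousOn_tfae isOpen_univ ⟨x₀, trivial⟩).out 3 1
  exact continuousOn_univ.1 (htfae.1 ⟨x₀, trivial, hbdd⟩)

/-- A continuous convex function has a subgradient at every point. -/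
theorem subdifferential_nonempty {h : X → ℝ} (hc : ConvexOn ℝ Set.univ h) (hcont : Continuous h)
    (x : X) : (subdifferential h x).Nonempty := by
  have hconv : Convex ℝ {p : X × ℝ | h p.1 < p.2} := by
    simpa using hc.convex_strict_epigraph
  have hopen : IsOpen {p : X × ℝ | h p.1 < p.2} :=
    isOpen_lt (hcont.comp continuous_fst) continuous_snd
  obtain ⟨F, hF⟩ := geometric_hahn_banach_point_open (x := (x, h x)) hconv hopen (by simp)
  have hsplit : ∀ (y : X) (t : ℝ), F (y, t) = F (y, 0) + t * F (0, 1) := fun y t => by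
    rw [← smul_eq_mul, ← map_smul, ← map_add]
    simp
  have hb : 0 < F (0, 1) := by
    have := hF (x, h x + 1) (by simp)
    rw [hsplit x (h x), hsplit x (h x + 1)] at this
    linarith
  refine ⟨-(F (0, 1))⁻¹ • F.comp (ContinuousLinearMap.inl ℝ X ℝ), fun y => ?_⟩
  refine le_of_forall_gt_imp_ge_of_dense fun t ht => ?_
  have h1 := hF (y, t) ht
  rw [hsplit x (h x), hsplit y t] at h1
  have h2 : F (y - x, 0) = F (y, 0) - F (x, 0) := by
    rw [← map_sub]
    simp
  simp only [smul_apply, ContinuousLinearMap.comp_apply,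
    ContinuousLinearMap.inl_apply, h2, smul_eq_mul]
  have h3 : F (x, 0) - F (y, 0) ≤ (t - h x) * F (0, 1) := by linarith
  have h4 : (F (0, 1))⁻¹ * (F (x, 0) - F (y, 0)) ≤ t - h x := by
    rw [inv_mul_le_iff₀ hb]
    linarith
  linarith

/-- Strong convexity at midpoints. -/
theorem IsStronglyConvex.midpoint_le {σ : ℝ} {h : X → ℝ} (hs : IsStronglyConvex σ h)
    (hne : ∀ x, (subdifferential h x).Nonempty) (x y : X) :
    2 * h ((1 / 2 : ℝ) • (x + y)) + σ / 4 * ‖x - y‖ ^ 2 ≤ h x + h y := by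
  obtain ⟨g, hg⟩ := hne ((1 / 2 : ℝ) • (x + y))
  have hx := hs _ x g hg
  have hy := hs _ y g hg
  have ex : x - (1 / 2 : ℝ) • (x + y) = (1 / 2 : ℝ) • (x - y) := by module
  have ey : y - (1 / 2 : ℝ) • (x + y) = -((1 / 2 : ℝ) • (x - y)) := by module
  rw [ex, norm_smul] at hx
  rw [ey, map_neg, norm_neg, norm_smul] at hy
  norm_num only [mul_pow, Real.norm_eq_abs, abs_of_pos] at hx hy
  linarith

/-- A strongly convex function that has subgradients everywhere is bounded below after subtraction
of a continuous linear functional. -/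
theorem IsStronglyConvex.bddBelow_sub {σ : ℝ} (hσ : 0 < σ) {h : X → ℝ}
    (hs : IsStronglyConvex σ h) (hne : ∀ x, (subdifferential h x).Nonempty)
    (u : StrongDual ℝ X) : BddBelow (Set.range fun x => h x - u x) := by
  obtain ⟨g, hg⟩ := hne 0
  refine ⟨h 0 - ‖g - u‖ ^ 2 / (2 * σ), ?_⟩
  rintro _ ⟨x, rfl⟩
  have h1 := hs 0 x g hg
  have h2 : -(‖g - u‖ * ‖x‖) ≤ g x - u x := by
    have := (abs_le.1 ((g - u).le_opNorm x)).1
    simpa using this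
  have h3 : ‖g - u‖ * ‖x‖ ≤ ‖g - u‖ ^ 2 / (2 * σ) + σ / 2 * ‖x‖ ^ 2 := by
    have : ‖g - u‖ ^ 2 / (2 * σ) + σ / 2 * ‖x‖ ^ 2 - ‖g - u‖ * ‖x‖
        = (‖g - u‖ - σ * ‖x‖) ^ 2 / (2 * σ) := by
      field_simp
      ring
    have h4 : 0 ≤ (‖g - u‖ - σ * ‖x‖) ^ 2 / (2 * σ) := by positivity
    linarith
  simp only [sub_zero] at h1
  dsimp only
  linarith

/-- Every continuous linear functional is a subgradient of a strongly convex closed function: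
minimizing sequences of `h - u` are Cauchy. -/
theorem IsStronglyConvex.exists_mem_subdifferential [CompleteSpace X] {σ : ℝ} (hσ : 0 < σ)
    {h : X → ℝ} (hs : IsStronglyConvex σ h) (hh : IsCCP h) (u : StrongDual ℝ X) :
    ∃ x, u ∈ subdifferential h x := by
  have hcont := hh.continuous
  have hne := subdifferential_nonempty hh.convex hcont
  have hbdd := hs.bddBelow_sub hσ hne u
  set I := ⨅ x, (h x - u x) with hI
  have hIle : ∀ x, I ≤ h x - u x := fun x => ciInf_le hbdd x
  have hseq : ∀ n : ℕ, ∃ x, h x - u x < I + 1 / ((n : ℝ) + 1) := fun n =>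
    exists_lt_of_ciInf_lt (by
      rw [← hI]
      have : (0 : ℝ) < 1 / ((n : ℝ) + 1) := by positivity
      linarith)
  choose x hx using hseq
  have hdist : ∀ m n N : ℕ, N ≤ m → N ≤ n →
      dist (x m) (x n) ≤ √(8 / σ * (1 / ((N : ℝ) + 1))) := fun m n N hm hn => by
    have h1 := hs.midpoint_le hne (x m) (x n)
    have h2 := hIle ((1 / 2 : ℝ) • (x m + x n))
    simp only [map_smul, map_add, smul_eq_mul] at h2
    have h3 : 1 / ((m : ℝ) + 1) ≤ 1 / ((N : ℝ) + 1) := Nat.one_div_le_one_div hm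
    have h4 : 1 / ((n : ℝ) + 1) ≤ 1 / ((N : ℝ) + 1) := Nat.one_div_le_one_div hn
    have h5 : σ / 4 * ‖x m - x n‖ ^ 2 ≤ 2 * (1 / ((N : ℝ) + 1)) := by
      linarith [hx m, hx n]
    refine Real.le_sqrt_of_sq_le ?_
    rw [dist_eq_norm, div_mul_eq_mul_div, le_div_iff₀ hσ]
    linarith
  have hlim : Tendsto (fun N : ℕ => √(8 / σ * (1 / ((N : ℝ) + 1)))) atTop (𝓝 0) := by
    have := (tendsto_one_div_add_atTop_nhds_zero_nat (𝕜 := ℝ)).const_mul (8 / σ)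
    simpa using this.sqrt
  obtain ⟨z, hz⟩ := cauchySeq_tendsto_of_complete (cauchySeq_of_le_tendsto_0 _ hdist hlim)
  have hval : h z - u z ≤ I := by
    have h1 : Tendsto (fun n => h (x n) - u (x n)) atTop (𝓝 (h z - u z)) :=
      ((hcont.sub u.continuous).tendsto z).comp hz
    have h2 : Tendsto (fun n : ℕ => I + 1 / ((n : ℝ) + 1)) atTop (𝓝 (I + 0)) :=
      tendsto_const_nhds.add tendsto_one_div_add_atTop_nhds_zero_nat
    rw [add_zero] at h2
    exact le_of_tendsto_of_tendsto' h1 h2 fun n => (hx n).le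
  refine ⟨z, fun y => ?_⟩
  have := hIle y
  rw [map_sub]
  linarith

end Subgradients

section Conjugate

variable {X : Type*} [NormedAddCommGroup X] [NormedSpace ℝ X]

/-- Equality in the Fenchel–Young inequality. -/
theorem conj_eq_of_mem_subdifferential {h : X → ℝ} {u : StrongDual ℝ X} {x : X}
    (hu : u ∈ subdifferential h x) : conj h u = ((u x - h x : ℝ) : EReal) := by
  refine le_antisymm (iSup_le fun y => EReal.coe_le_coe_iff.2 ?_)
    (le_iSup (fun x : X => ((u x - h x : ℝ) : EReal)) x)
  have := hu y
  rw [map_sub] at this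
  linarith

theorem toReal_conj_of_mem_subdifferential {h : X → ℝ} {u : StrongDual ℝ X} {x : X}
    (hu : u ∈ subdifferential h x) : (conj h u).toReal = u x - h x := by
  rw [conj_eq_of_mem_subdifferential hu, EReal.toReal_coe]

/-- The conjugate of a `σ`-strongly convex function satisfies the cocoercivity inequality. -/
theorem IsStronglyConvex.conj_cocoercive {σ : ℝ} {h : X → ℝ} (hs : IsStronglyConvex σ h)
    {u v : StrongDual ℝ X} {x y : X} (hu : u ∈ subdifferential h x)
    (hv : v ∈ subdifferential h y) :
    (conj h u).toReal + (v - u) x + σ / 2 * ‖x - y‖ ^ 2 ≤ (conj h v).toReal := by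
  rw [toReal_conj_of_mem_subdifferential hu, toReal_conj_of_mem_subdifferential hv]
  have := hs y x v hv
  rw [map_sub] at this
  rw [sub_apply]
  linarith

/-- The conjugate of a `σ`-strongly convex function is bounded above by its quadratic upper
model. -/
theorem IsStronglyConvex.conj_le {σ : ℝ} (hσ : 0 < σ) {h : X → ℝ} (hs : IsStronglyConvex σ h)
    {u v : StrongDual ℝ X} {x y : X} (hu : u ∈ subdifferential h x)
    (hv : v ∈ subdifferential h y) :
    (conj h v).toReal ≤ (conj h u).toReal + (v - u) x + ‖v - u‖ ^ 2 / (2 * σ) := by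
  rw [toReal_conj_of_mem_subdifferential hu, toReal_conj_of_mem_subdifferential hv]
  have h1 := hs x y u hu
  have h2 : (v - u) (y - x) ≤ ‖v - u‖ * ‖y - x‖ :=
    (le_abs_self _).trans ((v - u).le_opNorm _)
  have h3 : ‖v - u‖ ^ 2 / (2 * σ) + σ / 2 * ‖y - x‖ ^ 2 - ‖v - u‖ * ‖y - x‖
      = (‖v - u‖ - σ * ‖y - x‖) ^ 2 / (2 * σ) := by
    field_simp
    ring
  have h4 : 0 ≤ (‖v - u‖ - σ * ‖y - x‖) ^ 2 / (2 * σ) := by positivity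
  simp only [sub_apply, map_sub] at h1 h2 ⊢
  linarith

theorem HasGradient.unique {F : StrongDual ℝ X → EReal} {u : StrongDual ℝ X} {x y : X}
    (hx : HasGradient F u x) (hy : HasGradient F u y) : x = y :=
  (NormedSpace.inclusionInDoubleDualLi ℝ (E := X)).injective
    (hx.hasFDerivAt.unique hy.hasFDerivAt)

/-- The conjugate of a closed `σ`-strongly convex function is Fréchet differentiable, and its
gradients are the inverse of the subdifferential. -/
theorem IsStronglyConvex.hasGradient_conj [CompleteSpace X] {σ : ℝ} (hσ : 0 < σ) {h : X → ℝ}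
    (hs : IsStronglyConvex σ h) (hh : IsCCP h) {u : StrongDual ℝ X} {x : X}
    (hu : u ∈ subdifferential h x) : HasGradient (conj h) u x := by
  refine ⟨Eventually.of_forall fun v => ?_, ?_⟩
  · obtain ⟨y, hv⟩ := hs.exists_mem_subdifferential hσ hh v
    rw [conj_eq_of_mem_subdifferential hv]
    exact ⟨EReal.coe_ne_bot _, EReal.coe_ne_top _⟩
  · refine HasFDerivAt.of_isLittleO ?_
    have hO : (fun v => (conj h v).toReal - (conj h u).toReal
        - NormedSpace.inclusionInDoubleDual ℝ X x (v - u)) =O[𝓝 u] fun v => ‖v - u‖ ^ 2 := by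
      refine Asymptotics.IsBigO.of_bound (1 / (2 * σ)) (Eventually.of_forall fun v => ?_)
      obtain ⟨y, hv⟩ := hs.exists_mem_subdifferential hσ hh v
      have h1 := hs.conj_cocoercive hu hv
      have h2 := hs.conj_le hσ hu hv
      have h3 : 0 ≤ σ / 2 * ‖x - y‖ ^ 2 := by positivity
      rw [NormedSpace.dual_def, Real.norm_of_nonneg (by linarith), Real.norm_of_nonneg (by positivity),
        one_div_mul_eq_div]
      linarith
    refine hO.trans_isLittleO ?_
    have h1 : Tendsto (fun v : StrongDual ℝ X => v - u) (𝓝 u) (𝓝 0) := by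
      have : Continuous fun v : StrongDual ℝ X => v - u := by fun_prop
      simpa using this.tendsto u
    exact (Asymptotics.isLittleO_norm_pow_id one_lt_two).comp_tendsto h1

theorem IsStronglyConvex.existsUnique_hasGradient_conj [CompleteSpace X] {σ : ℝ} (hσ : 0 < σ)
    {h : X → ℝ} (hs : IsStronglyConvex σ h) (hh : IsCCP h) (u : StrongDual ℝ X) :
    ∃! x, HasGradient (conj h) u x := by
  obtain ⟨x, hx⟩ := hs.exists_mem_subdifferential hσ hh u
  exact ⟨x, hs.hasGradient_conj hσ hh hx, fun y hy => hy.unique (hs.hasGradient_conj hσ hh hx)⟩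

end Conjugate

section Smooth

variable {X : Type*} [NormedAddCommGroup X] [NormedSpace ℝ X] {L : ℝ} {f : X → ℝ}

/-- The descent lemma. -/
theorem IsLSmooth.le_quadratic (hf : IsLSmooth L f) (x w : X) :
    f (x + w) ≤ f x + fderiv ℝ f x w + L / 2 * ‖w‖ ^ 2 := by
  have hderiv : ∀ t : ℝ, HasDerivAt
      (fun t : ℝ => f (x + t • w) - t * fderiv ℝ f x w - L / 2 * ‖w‖ ^ 2 * t ^ 2)
      (fderiv ℝ f (x + t • w) w - fderiv ℝ f x w - L * ‖w‖ ^ 2 * t) t := fun t => by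
    have h1 : HasDerivAt (fun t : ℝ => x + t • w) w t := by
      simpa using ((hasDerivAt_id t).smul_const w).const_add x
    have h2 := (hf.differentiable (x + t • w)).hasFDerivAt.comp_hasDerivAt t h1
    have h3 := (hasDerivAt_id t).mul_const (fderiv ℝ f x w)
    have h4 := ((hasDerivAt_id t).pow 2).const_mul (L / 2 * ‖w‖ ^ 2)
    refine ((h2.sub h3).sub h4).congr_deriv ?_
    simp
    ring
  have hanti := antitoneOn_of_deriv_nonpos (convex_Icc (0 : ℝ) 1)
    (fun t _ => (hderiv t).continuousAt.continuousWithinAt)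
    (fun t _ => (hderiv t).differentiableAt.differentiableWithinAt) (fun t ht => by
      rw [interior_Icc] at ht
      rw [(hderiv t).deriv]
      have h1 := hf.lipschitz (x + t • w) x
      rw [add_sub_cancel_left, norm_smul, Real.norm_of_nonneg ht.1.le] at h1
      have h2 := (le_abs_self _).trans ((fderiv ℝ f (x + t • w) - fderiv ℝ f x).le_opNorm w)
      rw [sub_apply] at h2
      have h3 := mul_le_mul_of_nonneg_right h1 (norm_nonneg w)
      linarith)
  have := hanti (Set.left_mem_Icc.2 zero_le_one) (Set.right_mem_Icc.2 zero_le_one) zero_le_one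
  simp at this
  linarith

theorem fderiv_mem_subdifferential (hc : ConvexOn ℝ Set.univ f) {x : X}
    (hd : DifferentiableAt ℝ f x) : fderiv ℝ f x ∈ subdifferential f x := fun y => by
  have hline : ConvexOn ℝ Set.univ fun t : ℝ => f (x + t • (y - x)) := by
    have := hc.comp_affineMap (AffineMap.lineMap x y : ℝ →ᵃ[ℝ] X)
    rw [Set.preimage_univ] at this
    refine this.congr fun t _ => ?_
    simp [AffineMap.lineMap_apply, add_comm]
  have h1 : HasDerivAt (fun t : ℝ => f (x + t • (y - x))) (fderiv ℝ f x (y - x)) 0 := by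
    have h2 : HasDerivAt (fun t : ℝ => x + t • (y - x)) (y - x) 0 := by
      simpa using ((hasDerivAt_id (0 : ℝ)).smul_const (y - x)).const_add x
    have h3 : HasFDerivAt f (fderiv ℝ f x) (x + (0 : ℝ) • (y - x)) := by
      simpa using hd.hasFDerivAt
    exact h3.comp_hasDerivAt 0 h2
  have := hline.le_slope_of_hasDerivAt (Set.mem_univ 0) (Set.mem_univ 1) one_pos h1
  simp [slope] at this
  rw [map_sub]
  linarith

/-- Cocoercivity of the gradient of an `L`-smooth convex function. -/
theorem IsLSmooth.cocoercive (hL : 0 < L) (hf : IsLSmooth L f) (hc : ConvexOn ℝ Set.univ f)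
    (x y : X) :
    f y + fderiv ℝ f y (x - y) + 1 / (2 * L) * ‖fderiv ℝ f x - fderiv ℝ f y‖ ^ 2 ≤ f x := by
  set c := f x - f y - fderiv ℝ f y (x - y) with hcdef
  have hgap : ∀ w : X, (fderiv ℝ f x - fderiv ℝ f y) w ≤ c + L / 2 * ‖w‖ ^ 2 := fun w => by
    have h1 := fderiv_mem_subdifferential hc (hf.differentiable y) (x + -w)
    have h2 := hf.le_quadratic x (-w)
    simp only [map_neg, norm_neg, map_sub, map_add, sub_apply, hcdef]
      at h1 h2 ⊢
    linarith
  have hc0 : 0 ≤ c := by simpa using hgap 0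
  have hbound : ‖fderiv ℝ f x - fderiv ℝ f y‖ ≤ √(2 * L * c) := by
    refine ContinuousLinearMap.opNorm_le_bound _ (Real.sqrt_nonneg _) fun w => ?_
    have h1 : ∀ t : ℝ, 0 ≤ L / 2 * ‖w‖ ^ 2 * (t * t)
        + -((fderiv ℝ f x - fderiv ℝ f y) w) * t + c := fun t => by
      have := hgap (t • w)
      rw [map_smul, norm_smul, mul_pow, Real.norm_eq_abs, sq_abs, smul_eq_mul] at this
      linarith
    have h2 := discrim_le_zero h1
    rw [discrim] at h2
    rw [Real.norm_eq_abs]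
    refine abs_le_of_sq_le_sq ?_ (by positivity)
    rw [mul_pow, Real.sq_sqrt (by positivity)]
    linarith
  have h1 : ‖fderiv ℝ f x - fderiv ℝ f y‖ ^ 2 ≤ 2 * L * c := by
    have := pow_le_pow_left₀ (norm_nonneg _) hbound 2
    rwa [Real.sq_sqrt (by positivity)] at this
  have h2 : 1 / (2 * L) * ‖fderiv ℝ f x - fderiv ℝ f y‖ ^ 2 ≤ c := by
    rw [one_div_mul_eq_div, div_le_iff₀ (by positivity)]
    linarith
  linarith

end Smooth

section Parameters

variable {N : ℕ} {θ : ℤ → ℝ}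

theorem IsParamSeq.pred_le (hθ : IsParamSeq N θ) {i : ℤ} (h0 : 0 ≤ i) (hi : i ≤ N) :
    θ (i - 1) ≤ θ i := by
  rcases h0.eq_or_lt with rfl | h1
  · simpa [hθ.neg_one] using (hθ.pos 0 le_rfl hi).le
  · simpa using hθ.mono (i - 1) (by omega) (by omega)

theorem IsParamSeq.pred_nonneg (hθ : IsParamSeq N θ) {i : ℤ} (h0 : 0 ≤ i) (hi : i ≤ N) :
    0 ≤ θ (i - 1) := by
  rcases h0.eq_or_lt with rfl | h1
  · simp [hθ.neg_one]
  · exact (hθ.pos (i - 1) (by omega) (by omega)).le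

theorem IsParamSeq.sq_pred_le (hθ : IsParamSeq N θ) {i : ℤ} (h0 : 0 ≤ i) (hi : i ≤ N) :
    θ (i - 1) ^ 2 ≤ θ i ^ 2 :=
  pow_le_pow_left₀ (hθ.pred_nonneg h0 hi) (hθ.pred_le h0 hi) 2

/-- Linear growth of the parameters when the defining inequalities are equalities. -/
theorem IsParamSeq.linear_growth (hθ : IsParamSeq N θ)
    (heq : ∀ i : ℤ, 0 ≤ i → i < N → θ i ^ 2 - θ i = θ (i - 1) ^ 2) (n : ℕ) (hn : n < N) :
    ((n : ℝ) + 2) / 2 ≤ θ n := by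
  induction n with
  | zero =>
    have h1 := heq 0 le_rfl (by exact_mod_cast hn)
    have h2 := hθ.pos 0 le_rfl (by omega)
    rw [zero_sub, hθ.neg_one] at h1
    have h3 : θ 0 * (θ 0 - 1) = 0 := by linarith
    rcases mul_eq_zero.1 h3 with h4 | h4
    · linarith
    · simp
      linarith
  | succ n ih =>
    have h1 := heq ((n + 1 : ℕ) : ℤ) (by positivity) (by exact_mod_cast hn)
    have h2 := hθ.pos ((n + 1 : ℕ) : ℤ) (by positivity) (by exact_mod_cast hn.le)
    have h3 : (((n + 1 : ℕ) : ℤ) - 1) = (n : ℤ) := by push_cast; ring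
    rw [h3] at h1
    have h4 := ih (by omega)
    have h5 : 0 ≤ (n : ℝ) := n.cast_nonneg
    push_cast at h1 h2 ⊢
    have h6 : 1 < θ ((n : ℤ) + 1) := by
      by_contra! hle
      nlinarith
    have h7 : θ n ≤ θ ((n : ℤ) + 1) - 1 / 2 := by
      refine le_of_sq_le_sq ?_ (by linarith)
      linarith
    linarith

end Parameters

section Trajectories

variable {X : Type*} [NormedAddCommGroup X] [NormedSpace ℝ X]

theorem IsDualAMD.unique {f ψ : X → ℝ} {L σ : ℝ} {N : ℕ} {θ : ℤ → ℝ} {q0 : X}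
    {z w : Trajectory X N} (hz : IsDualAMD f ψ L σ N θ q0 z) (hw : IsDualAMD f ψ L σ N θ q0 w) :
    z = w := by
  have key : ∀ k : Fin (N + 1), z.q k = w.q k ∧ z.g k = w.g k ∧ z.r k = w.r k := by
    intro k
    induction k using Fin.induction with
    | zero =>
      have h : z.q 0 = w.q 0 := hz.q_zero.trans hw.q_zero.symm
      exact ⟨h, by rw [hz.g_zero, hw.g_zero, h], by rw [hz.r_zero, hw.r_zero, h]⟩
    | succ k ih =>
      obtain ⟨hq, hg, hr⟩ := ih
      obtain ⟨x, hx, hqx⟩ := hz.q_succ k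
      obtain ⟨y, hy, hqy⟩ := hw.q_succ k
      rw [hr] at hx
      have hq' : z.q k.succ = w.q k.succ := by rw [hqx, hqy, hq, hx.unique hy]
      have hg' : z.g k.succ = w.g k.succ := by rw [hz.g_succ, hw.g_succ, hq, hg, hq']
      exact ⟨hq', hg', by rw [hz.r_succ, hw.r_succ, hr, hg, hg']⟩
  obtain ⟨zq, zg, zr⟩ := z
  obtain ⟨wq, wg, wr⟩ := w
  congr
  · exact funext fun k => (key k).1
  · exact funext fun k => (key k).2.1
  · exact funext fun k => (key k).2.2

/-- The method produces a trajectory as soon as the conjugate is differentiable everywhere. -/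
theorem exists_isDualAMD {f ψ : X → ℝ} (L σ : ℝ) (N : ℕ) (θ : ℤ → ℝ) (q0 : X)
    (hgrad : ∀ u, ∃ x, HasGradient (conj ψ) u x) :
    ∃ z : Trajectory X N, IsDualAMD f ψ L σ N θ q0 z := by
  choose G hG using hgrad
  let a : ℕ → ℝ := fun k => θ ((N : ℤ) - k - 1) ^ 2 - θ ((N : ℤ) - k - 2) ^ 2
  let q' : ℕ → X → StrongDual ℝ X → X := fun k q r => q - (σ / L * a k) • G r
  let g' : ℕ → X → StrongDual ℝ X → StrongDual ℝ X → StrongDual ℝ X := fun k q g r =>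
    g + (1 / θ ((N : ℤ) - k - 1) ^ 2) • (fderiv ℝ f (q' k q r) - fderiv ℝ f q)
  let s : ℕ → X × StrongDual ℝ X × StrongDual ℝ X := fun n => Nat.rec
    (q0, (1 / θ N ^ 2) • fderiv ℝ f q0,
      ((θ N ^ 2 - θ (N - 2) ^ 2) / θ N ^ 2) • fderiv ℝ f q0)
    (fun k p => (q' k p.1 p.2.2, g' k p.1 p.2.1 p.2.2,
      p.2.2 + a k • (g' k p.1 p.2.1 p.2.2 - p.2.1)
        + (θ ((N : ℤ) - k - 2) ^ 2 - θ ((N : ℤ) - k - 3) ^ 2) • g' k p.1 p.2.1 p.2.2)) n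
  exact ⟨⟨fun k => (s k).1, fun k => (s k).2.1, fun k => (s k).2.2⟩,
    ⟨rfl, rfl, rfl, fun k => ⟨_, hG _, rfl⟩, fun _ => rfl, fun _ => rfl⟩⟩

/-- The last dual iterate is the gradient at the last primal iterate. -/
theorem IsDualAMD.r_last {f ψ : X → ℝ} {L σ : ℝ} {N : ℕ} {θ : ℤ → ℝ} (hθ : IsParamSeq N θ)
    {q0 : X} {z : Trajectory X N} (hz : IsDualAMD f ψ L σ N θ q0 z) :
    z.r (Fin.last N) = fderiv ℝ f (z.q (Fin.last N)) := by
  have hN : θ N ≠ 0 := (hθ.pos N (by positivity) le_rfl).ne'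
  have key : ∀ k : Fin (N + 1),
      z.r k + θ ((N : ℤ) - (k : ℕ) - 2) ^ 2 • z.g k = fderiv ℝ f (z.q k) := by
    intro k
    induction k using Fin.induction with
    | zero =>
      rw [hz.g_zero, hz.r_zero, smul_smul, ← add_smul]
      simp only [Fin.val_zero, Nat.cast_zero, sub_zero]
      rw [show (θ N ^ 2 - θ (N - 2) ^ 2) / θ N ^ 2 + θ (N - 2) ^ 2 * (1 / θ N ^ 2) = 1 by
        field_simp; ring, one_smul]
    | succ k ih =>
      have hpos : θ ((N : ℤ) - (k : ℕ) - 1) ≠ 0 :=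
        (hθ.pos _ (by have := k.2; omega) (by omega)).ne'
      have hd : fderiv ℝ f (z.q k.succ) - fderiv ℝ f (z.q k.castSucc)
          = θ ((N : ℤ) - (k : ℕ) - 1) ^ 2 • (z.g k.succ - z.g k.castSucc) := by
        rw [hz.g_succ, add_sub_cancel_left, smul_smul, mul_one_div_cancel (pow_ne_zero 2 hpos),
          one_smul]
      rw [hz.r_succ, eq_add_of_sub_eq hd, ← ih, Fin.val_succ, Fin.val_castSucc,
        show (N : ℤ) - ((k : ℕ) + 1 : ℕ) - 2 = (N : ℤ) - (k : ℕ) - 3 by push_cast; ring]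
      module
  have h := key (Fin.last N)
  rwa [Fin.val_last, sub_self, zero_sub, hθ.neg_two, zero_pow two_ne_zero, zero_smul,
    add_zero] at h

/-- One step of the potential function argument behind the convergence rate. The parameters
`l ≤ l'` are the reciprocals of two consecutive squared parameters of the method. -/
theorem potential_step {L σ l l' a a' F0 F F' FN P P' : ℝ} (hL : 0 < L) (hσ : 0 < σ)
    (hl' : 0 ≤ l') (hll' : l ≤ l') (ha : 0 ≤ a) (hal : l' * a ^ 2 ≤ 1)
    {d d' g g' r r' : StrongDual ℝ X} {h h' q q' qN : X}
    (hq : q' = q - (σ / L * a) • h) (hg : g' = g + l' • (d' - d))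
    (hr : r' = r + a • (g' - g) + a' • g')
    (hsub : F + d (qN - q) ≤ FN)
    (hcoco : F' + d' (q - q') + 1 / (2 * L) * ‖d - d'‖ ^ 2 ≤ F)
    (hconj : P' + (r - r') h' + σ / 2 * ‖h' - h‖ ^ 2 ≤ P)
    (hpot : σ / L * P ≤ F0 - l * F + l * FN - (l • d - g) (qN - q) + σ / L * (a * g h)) :
    σ / L * P' ≤ F0 - l' * F' + l' * FN - (l' • d' - g') (qN - q') + σ / L * (a' * g' h') := by
  have hquad : σ / L * (a * (l' * (d' - d) (h' - h)))
      ≤ σ / L * (σ / 2 * ‖h' - h‖ ^ 2) + l' * (1 / (2 * L) * ‖d - d'‖ ^ 2) := by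
    have h1 : (d' - d) (h' - h) ≤ ‖d - d'‖ * ‖h' - h‖ := by
      rw [norm_sub_rev d d']
      exact (le_abs_self _).trans ((d' - d).le_opNorm _)
    have h2 : 2 * σ * (a * l') * (‖d - d'‖ * ‖h' - h‖)
        ≤ σ ^ 2 * ‖h' - h‖ ^ 2 + l' * ‖d - d'‖ ^ 2 := by
      have h3 := mul_le_mul_of_nonneg_right hal (mul_nonneg hl' (sq_nonneg ‖d - d'‖))
      linarith [sq_nonneg (σ * ‖h' - h‖ - a * l' * ‖d - d'‖)]
    have h4 := mul_le_mul_of_nonneg_left h1 (by positivity : 0 ≤ 2 * σ * (a * l'))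
    have h5 : σ / L * (σ / 2 * ‖h' - h‖ ^ 2) + l' * (1 / (2 * L) * ‖d - d'‖ ^ 2)
        - σ / L * (a * (l' * (d' - d) (h' - h)))
        = (σ ^ 2 * ‖h' - h‖ ^ 2 + l' * ‖d - d'‖ ^ 2 - 2 * σ * (a * l') * (d' - d) (h' - h))
          / (2 * L) := by
      field_simp
    have h6 : 0 ≤ (σ ^ 2 * ‖h' - h‖ ^ 2 + l' * ‖d - d'‖ ^ 2
        - 2 * σ * (a * l') * (d' - d) (h' - h)) / (2 * L) :=
      div_nonneg (by linarith) (by positivity)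
    linarith
  have hJ := mul_le_mul_of_nonneg_left hsub (sub_nonneg.2 hll')
  have hI := mul_le_mul_of_nonneg_left hcoco hl'
  have hB := mul_le_mul_of_nonneg_left hconj (by positivity : 0 ≤ σ / L)
  subst hr hg hq
  simp only [sub_apply, add_apply, smul_apply, map_sub, map_smul, smul_eq_mul] at *
  linarith

/-- Convergence rate of dual accelerated mirror descent, in terms of the last function value. -/
theorem IsDualAMD.rate {f ψ : X → ℝ} {L σ : ℝ} {N : ℕ} {θ : ℤ → ℝ} {q0 : X} [CompleteSpace X]
    (hf : ConvexOn ℝ Set.univ f) (hfL : IsLSmooth L f) (hψ : IsCCP ψ)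
    (hψσ : IsStronglyConvex σ ψ) (hL : 0 < L) (hσ : 0 < σ) (hθ : IsParamSeq N θ)
    {z : Trajectory X N} (hz : IsDualAMD f ψ L σ N θ q0 z) (h0 : conj ψ 0 = 0) :
    (conj ψ (z.r (Fin.last N))).toReal
      ≤ L / (σ * θ N ^ 2) * (f q0 - f (z.q (Fin.last N))) := by
  choose h hh using fun u => hψσ.exists_mem_subdifferential hσ hψ u
  have hN : 0 < θ N := hθ.pos N (by positivity) le_rfl
  set qN := z.q (Fin.last N) with hqN
  have key : ∀ k : Fin (N + 1), σ / L * (conj ψ (z.r k)).toReal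
      ≤ 1 / θ N ^ 2 * (f q0 - f qN) - 1 / θ ((N : ℤ) - (k : ℕ)) ^ 2 * f (z.q k)
        + 1 / θ ((N : ℤ) - (k : ℕ)) ^ 2 * f qN
        - ((1 / θ ((N : ℤ) - (k : ℕ)) ^ 2) • fderiv ℝ f (z.q k) - z.g k) (qN - z.q k)
        + σ / L * ((θ ((N : ℤ) - (k : ℕ) - 1) ^ 2 - θ ((N : ℤ) - (k : ℕ) - 2) ^ 2)
          * z.g k (h (z.r k))) := by
    intro k
    induction k using Fin.induction with
    | zero =>
      have hr : z.r 0 = (θ (N - 1) ^ 2 - θ (N - 2) ^ 2) • z.g 0 := by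
        rw [hz.r_zero, hz.g_zero, smul_smul, mul_one_div, hθ.last]
      have h1 := hψσ.conj_cocoercive (hh (z.r 0)) (hh 0)
      have h2 : 0 ≤ σ / 2 * ‖h (z.r 0) - h 0‖ ^ 2 := by positivity
      have h3 : (conj ψ (z.r 0)).toReal
          ≤ (θ (N - 1) ^ 2 - θ (N - 2) ^ 2) * z.g 0 (h (z.r 0)) := by
        rw [h0, zero_sub, neg_apply, EReal.toReal_zero] at h1
        have h4 : z.r 0 (h (z.r 0))
            = (θ (N - 1) ^ 2 - θ (N - 2) ^ 2) * z.g 0 (h (z.r 0)) := by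
          conv_lhs => rw [hr]
          rw [smul_apply, smul_eq_mul, ← hr]
        linarith
      have h5 := mul_le_mul_of_nonneg_left h3 (by positivity : 0 ≤ σ / L)
      simp only [Fin.val_zero, Nat.cast_zero, sub_zero]
      rw [← hz.g_zero, sub_self, hz.q_zero, zero_apply]
      linarith
    | succ k ih =>
      have hk := k.2
      set i : ℤ := (N : ℤ) - (k : ℕ) - 1 with hi
      have hi0 : 0 ≤ i := by omega
      have hiN : i < N := by omega
      have hpos := hθ.pos i hi0 hiN.le
      have e0 : (N : ℤ) - (k.castSucc : ℕ) = i + 1 := by rw [Fin.val_castSucc]; omega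
      have e1 : (N : ℤ) - (k.succ : ℕ) = i := by rw [Fin.val_succ]; omega
      have e2 : i + 1 - 2 = i - 1 := by ring
      obtain ⟨x, hx, hq⟩ := hz.q_succ k
      have hxh : x = h (z.r k.castSucc) := hx.unique (hψσ.hasGradient_conj hσ hψ (hh _))
      have hg := hz.g_succ k
      have hr := hz.r_succ k
      have e3 : (N : ℤ) - (k : ℕ) - 2 = i - 1 := by omega
      have e4 : (N : ℤ) - (k : ℕ) - 3 = i - 2 := by omega
      rw [← hi, e3] at hq hr
      rw [← hi] at hg
      rw [e4] at hr
      rw [hxh] at hq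
      rw [e0, add_sub_cancel_right, e2] at ih
      rw [e1]
      have hdiff : 0 ≤ θ i ^ 2 - θ (i - 1) ^ 2 := sub_nonneg.2 (hθ.sq_pred_le hi0 hiN.le)
      have hmono : θ i ^ 2 ≤ θ (i + 1) ^ 2 :=
        pow_le_pow_left₀ hpos.le (hθ.mono i hi0 hiN) 2
      refine potential_step hL hσ (by positivity)
        (one_div_le_one_div_of_le (by positivity) hmono) hdiff ?_ hq hg hr
        (fderiv_mem_subdifferential hf (hfL.differentiable _) qN)
        (hfL.cocoercive hL hf _ _) (hψσ.conj_cocoercive (hh _) (hh _)) ih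
      rw [one_div_mul_eq_div, div_le_one (by positivity)]
      exact pow_le_pow_left₀ hdiff (by linarith [hθ.step i hi0 hiN]) 2
  have hlast := key (Fin.last N)
  rw [Fin.val_last, ← hqN] at hlast
  simp only [sub_self, zero_sub, hθ.neg_one, hθ.neg_two, map_zero] at hlast
  have h1 : σ / L * (conj ψ (z.r (Fin.last N))).toReal ≤ 1 / θ N ^ 2 * (f q0 - f qN) := by
    linarith
  have h2 := mul_le_mul_of_nonneg_left h1 (by positivity : 0 ≤ L / σ)
  calc (conj ψ (z.r (Fin.last N))).toReal
      = L / σ * (σ / L * (conj ψ (z.r (Fin.last N))).toReal) := by field_simp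
    _ ≤ L / σ * (1 / θ N ^ 2 * (f q0 - f qN)) := h2
    _ = L / (σ * θ N ^ 2) * (f q0 - f qN) := by field_simp

end Trajectories

end DualAMD

theorem mainTheorem2 {X : Type*} [NormedAddCommGroup X] [NormedSpace ℝ X] [CompleteSpace X]
    (hX : DualAMD.IsReflexive X) (f ψ : X → ℝ) (hf : DualAMD.IsCCP f) (hψ : DualAMD.IsCCP ψ)
    (L σ : ℝ) (hL : 0 < L) (hσ : 0 < σ)
    (hfL : DualAMD.IsLSmooth L f) (hψσ : DualAMD.IsStronglyConvex σ ψ)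
    (N : ℕ) (hN : 1 ≤ N) (θ : ℤ → ℝ) (hθ : DualAMD.IsParamSeq N θ) (q0 : X) :
    (∀ u : StrongDual ℝ X, ∃! x : X, DualAMD.HasGradient (DualAMD.conj ψ) u x) ∧
    (∃! z : DualAMD.Trajectory X N, DualAMD.IsDualAMD f ψ L σ N θ q0 z) ∧
    ∀ z : DualAMD.Trajectory X N, DualAMD.IsDualAMD f ψ L σ N θ q0 z →
      z.r (Fin.last N) = fderiv ℝ f (z.q (Fin.last N)) ∧
      (DualAMD.conj ψ 0 = 0 →
        (∀ u : StrongDual ℝ X, u ≠ 0 → DualAMD.conj ψ 0 < DualAMD.conj ψ u) →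
        DualAMD.conj ψ (fderiv ℝ f (z.q (Fin.last N))) = DualAMD.conj ψ (z.r (Fin.last N)) ∧
        DualAMD.conj ψ (z.r (Fin.last N)) ≤
          ((L / (σ * θ N ^ 2) : ℝ) : EReal) * ((f q0 : EReal) - ⨅ x : X, (f x : EReal)) ∧
        ((∀ i : ℤ, 0 ≤ i → i < N → θ i ^ 2 - θ i = θ (i - 1) ^ 2) →
          ((L / (σ * θ N ^ 2) : ℝ) : EReal) * ((f q0 : EReal) - ⨅ x : X, (f x : EReal)) ≤
            ((4 * L / (σ * (N : ℝ) ^ 2) : ℝ) : EReal) *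
              ((f q0 : EReal) - ⨅ x : X, (f x : EReal)))) := by
  have hgrad := hψσ.existsUnique_hasGradient_conj hσ hψ
  obtain ⟨z₀, hz₀⟩ := DualAMD.exists_isDualAMD (f := f) L σ N θ q0 fun u => (hgrad u).exists
  refine ⟨hgrad, ⟨z₀, hz₀, fun z hz => hz.unique hz₀⟩, fun z hz => ⟨hz.r_last hθ, ?_⟩⟩
  intro h0 _
  have hN0 : 0 < θ N := hθ.pos N (by positivity) le_rfl
  refine ⟨by rw [hz.r_last hθ], ?_, fun heq => ?_⟩
  · obtain ⟨x, hx⟩ := hψσ.exists_mem_subdifferential hσ hψ (z.r (Fin.last N))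
    have hrate := hz.rate hf.convex hfL hψ hψσ hL hσ hθ h0
    rw [DualAMD.toReal_conj_of_mem_subdifferential hx] at hrate
    rw [DualAMD.conj_eq_of_mem_subdifferential hx]
    refine (EReal.coe_le_coe_iff.2 hrate).trans ?_
    rw [EReal.coe_mul, EReal.coe_sub]
    exact mul_le_mul_of_nonneg_left (EReal.sub_le_sub le_rfl (iInf_le _ _))
      (EReal.coe_nonneg.2 (by positivity))
  · have hgap : (0 : EReal) ≤ (f q0 : EReal) - ⨅ x : X, (f x : EReal) := by
      have h1 : (f q0 : EReal) - (f q0 : EReal) ≤ (f q0 : EReal) - ⨅ x : X, (f x : EReal) :=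
        EReal.sub_le_sub le_rfl (iInf_le _ _)
      rwa [← EReal.coe_sub, sub_self, EReal.coe_zero] at h1
    refine mul_le_mul_of_nonneg_right (EReal.coe_le_coe_iff.2 ?_) hgap
    have hNpos : (0 : ℝ) < N := by exact_mod_cast hN
    have hgrow := hθ.linear_growth heq (N - 1) (by omega)
    rw [Nat.cast_sub hN, Nat.cast_sub hN, Nat.cast_one, Nat.cast_one, ← hθ.last] at hgrow
    have hsq : (N : ℝ) ^ 2 ≤ 4 * θ N ^ 2 := by
      have := pow_le_pow_left₀ hNpos.le (by linarith : (N : ℝ) ≤ 2 * θ N) 2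
      linarith
    rw [div_le_div_iff₀ (by positivity) (by positivity)]
    have := mul_le_mul_of_nonneg_left hsq (by positivity : 0 ≤ L * σ)
    linarith
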